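/- Let $q$ be a prime power, let $k\ge 0$ and $\ell\ge 1$, and let $S_{1},S_{2}$ be subspaces of $\mathbb F_q^k$ of dimensions $u_1,u_2$ with $\dim(S_1\cap S_2)=0$; exclude the single case $q=k=2$, $u_1=u_2=1$. Let $G$ be a matrix whose columns are the elements of $\mathbb F_q^k\setminus(S_1\cup S_2)$, each occurring once, let $n$ be the number of its columns, and let $C_\ell$ be the lifted code over $\mathbb F_{q^\ell}$, that is, the $\mathbb F_{q^\ell}$-linear span of the rows of $G$. For $1\le i\le n$ and $1\le j\le k$ let $A_i^{(j)}$ be the number of $(k-j)$-dimensional subspaces of $\mathbb F_q^k$ that contain exactly $n-i$ of the $n$ columns of $G$. Write $\begin{bmatrix} a\\ b\end{bmatrix}=\prod_{s=0}^{b-1}\frac{q^a-q^s}{q^b-q^s}$ for integers $a,b\ge 0$, and $\begin{bmatrix} a\\ b\end{bmatrix}=0$ for $b<0$. For integers $d,t_1,t_2\ge 0$ put $$N(k,d,u_1,u_2,t_1,t_2)=\sum_{t=0}^{\min\{u_1-t_1,\,u_2-t_2\}}q^{(u_1+u_2-t-t_1-t_2)(d-t-t_1-t_2)}\,N_t\begin{bmatrix}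 k-u_1-u_2\\ d-t-t_1-t_2\end{bmatrix},$$ $$N_t=\prod_{s=0}^{t-1}(q^t-q^s)\begin{bmatrix} u_1-t_1\\ t\end{bmatrix}\begin{bmatrix} u_2-t_2\\ t\end{bmatrix}\begin{bmatrix} u_1\\ t_1\end{bmatrix}\begin{bmatrix} u_2\\ t_2\end{bmatrix},$$ where the sum is $0$ if $t_1>u_1$ or $t_2>u_2$. Then: (1) $C_\ell$ has length $n=q^k-q^{u_1}-q^{u_2}+1$. (2) The weight enumerator polynomial of $C_\ell$ (the coefficient of $z^i$ being the number of codewords of Hamming weight $i$) is $$A_\ell(z)=1+\sum_{i=1}^n\sum_{j=1}^kA_i^{(j)}(q^\ell-1)(q^\ell-q)\cdots(q^\ell-q^{j-1})z^i .$$ (3) Let $1\le i\le n$ and $1\le j\le k$. If $t_1,t_2$ are integers with $\max\{0,u_r-j\}\le t_r\le u_r$ for $r=1,2$ and $n-i=q^{k-j}-q^{t_1}-q^{t_2}+1$, then $$A_i^{(j)}=\begin{cases}N(k,k-j,u_1,u_2,t_1,t_2)+N(k,k-j,u_1,u_2,t_2,t_1), & t_1\ne t_2,\\ N(k,k-j,u_1,u_2,t_1,t_2),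 & t_1=t_2.\end{cases}$$ If no such $t_1,t_2$ exist, then $A_i^{(j)}=0$. (4) For all integers $d,t_1,t_2\ge 0$, $N(k,d,u_1,u_2,t_1,t_2)$ is the number of $d$-dimensional subspaces $V$ of $\mathbb F_q^k$ with $\dim(V\cap S_1)=t_1$ and $\dim(V\cap S_2)=t_2$. -/

import Mathlib

open Polynomial

noncomputable section

/-- The Gaussian (`q`-binomial) coefficient
`[n, m]_q = ∏_{s < m} (q ^ n - q ^ s) / (q ^ m - q ^ s)`; it vanishes for `m > n`. -/
def gaussBinom (q n m : ℕ) : ℚ :=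
  (∏ s ∈ Finset.range m, ((q : ℚ) ^ n - (q : ℚ) ^ s)) /
    ∏ s ∈ Finset.range m, ((q : ℚ) ^ m - (q : ℚ) ^ s)

/-- `N_t(k, u₁, u₂, t₁, t₂)`. For `t = 0` the product and the first two Gaussian coefficients
are equal to `1`, so that the value is `[u₁, t₁]_q [u₂, t₂]_q`. -/
def subspaceNt (q t u₁ u₂ t₁ t₂ : ℕ) : ℚ :=
  (∏ s ∈ Finset.range t, ((q : ℚ) ^ t - (q : ℚ) ^ s)) *
    gaussBinom q (u₁ - t₁) t * gaussBinom q (u₂ - t₂) t *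
    gaussBinom q u₁ t₁ * gaussBinom q u₂ t₂

/-- The explicit expression `N(k, d, u₁, u₂, t₁, t₂)`. A Gaussian coefficient with negative
lower index `d - t - t₁ - t₂` is zero. If `t₁ > u₁` or `t₂ > u₂` the value is zero, because
the corresponding factor `[u_r, t_r]_q` is. -/
def subspaceN (q k d u₁ u₂ t₁ t₂ : ℕ) : ℚ :=
  ∑ t ∈ Finset.range (min (u₁ - t₁) (u₂ - t₂) + 1),
    if t + t₁ + t₂ ≤ d then
      (q : ℚ) ^ ((u₁ + u₂ - t - t₁ - t₂) * (d - t - t₁ - t₂)) *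
        subspaceNt q t u₁ u₂ t₁ t₂ * gaussBinom q (k - u₁ - u₂) (d - t - t₁ - t₂)
    else 0

/-- The linear code (row space) generated by the rows of a matrix. -/
def rowCode {K : Type*} [Field K] {k n : ℕ} (G : Matrix (Fin k) (Fin n) K) :
    Submodule K (Fin n → K) :=
  Submodule.span K (Set.range fun a => G a)

/-- The lifted code: the code over the extension field `L` with the same generator matrix `G`. -/
def liftedCode {F : Type*} [Field F] (L : Type*) [Field L] [Algebra F L] {k n : ℕ}
    (G : Matrix (Fin k) (Fin n) F) : Submodule L (Fin n → L) :=
  rowCode (G.map (algebraMap F L))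

open Classical in
/-- The weight enumerator polynomial `∑ᵢ Aᵢ zⁱ`, with `Aᵢ` the number of codewords of Hamming
weight `i`. -/
def weightEnumerator {K : Type*} [Field K] {n : ℕ} (C : Submodule K (Fin n → K)) : ℤ[X] :=
  ∑ i ∈ Finset.range (n + 1), Polynomial.C (({c ∈ C | hammingNorm c = i}.ncard : ℕ) : ℤ) * X ^ i

/-- `G` is a matrix whose columns are the elements of `U`, each occurring exactly once, in some
order. -/
def HasColumns {F : Type*} {k n : ℕ} (G : Matrix (Fin k) (Fin n) F)
    (U : Set (Fin k → F)) : Prop :=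
  Set.BijOn (fun m a => G a m) Set.univ U

/-- `A_i^{(j)}`: the number of `(k - j)`-dimensional subspaces of `F ^ k` that contain exactly
`n - i` of the `n` columns of `G`. -/
def subspaceCount {F : Type*} [Field F] {k n : ℕ} (G : Matrix (Fin k) (Fin n) F)
    (i j : ℕ) : ℕ :=
  {V : Submodule F (Fin k → F) | Module.finrank F V + j = k ∧
    {m : Fin n | (fun a => G a m) ∈ V}.ncard + i = n}.ncard

/-- The pairs `(t₁, t₂)` with `max {0, u_r - j} ≤ t_r ≤ u_r` for `r = 1, 2` and
`n - i = q ^ (k - j) - q ^ t₁ - q ^ t₂ + 1`, for `i ≤ n` and `j ≤ k`. -/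
def IsDimPair (q k n u₁ u₂ i j t₁ t₂ : ℕ) : Prop :=
  (u₁ ≤ t₁ + j ∧ t₁ ≤ u₁) ∧ (u₂ ≤ t₂ + j ∧ t₂ ≤ u₂) ∧
    (n : ℤ) - i = (q : ℤ) ^ (k - j) - (q : ℤ) ^ t₁ - (q : ℤ) ^ t₂ + 1

end

/-! ### Counting subspaces through tuples independent modulo a subspace -/

section Counting

variable {F E : Type*} [Field F] [AddCommGroup E] [Module F E]

/-! Codewords of the lifted code are the value vectors, at the columns, of `F`-linear maps φ : F^k →
L; the weight is n minus the number of columns in ker φ. If the columns span F^k, the codeword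
determines φ. Grouping by kernel, weight i gets A_i^{(j)} kernels of codimension j, each belonging
to (q^ℓ-1)⋯(q^ℓ-q^{j-1}) maps: the embeddings of a j-dimensional space into L. Spanning is proved by
comparing sizes (`eq_top_of_compl_union_subset`), which is where the exceptional case matters.

A subspace V contains q^{dim V} - q^{t₁} - q^{t₂} + 1 columns, where t_r = dim(V ∩ S_r). Since
q^{t₁} + q^{t₂} determines {t₁, t₂} (`pow_add_pow_inj`), A_i^{(j)} reduces to counting the V with
given t₁, t₂ (`ncard_finrank_inf`). Such a V is built in three stages: T_r = V ∩ S_r; then W = V ∩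
(S₁ ⊕ S₂), of dimension t₁ + t₂ + t, which modulo T₁ ⊕ T₂ is the graph of an isomorphism between
t-dimensional subspaces of S₁/T₁ and S₂/T₂; then V itself. The factors of N and N_t are the numbers
of choices. Each stage is a count by fibers of constant size. -/

theorem ncard_eq_mul_of_fibers {α β : Type*} [Finite α] [Finite β] {s : Set α} {t : Set β}
    {f : α → β} (hf : ∀ a ∈ s, f a ∈ t) {N : ℚ}
    (h : ∀ b ∈ t, ({a | a ∈ s ∧ f a = b}.ncard : ℚ) = N) : (s.ncard : ℚ) = t.ncard * N := by
  classical
  have := Fintype.ofFinite α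
  have := Fintype.ofFinite β
  rw [Set.ncard_eq_toFinset_card', Set.ncard_eq_toFinset_card',
    Finset.card_eq_sum_card_fiberwise (f := f) (t := t.toFinset) (by
      intro a ha; simpa using hf a (by simpa using ha))]
  push_cast
  rw [Finset.sum_congr rfl (g := fun _ => N), Finset.sum_const, nsmul_eq_mul]
  intro b hb
  rw [← h b (by simpa using hb), Set.ncard_eq_toFinset_card']
  congr 2
  ext a; simp

/-- The `m`-tuples of elements of `A` that are linearly independent modulo `B`. -/
def indepTuples (A B : Submodule F E) (m : ℕ) : Set (Fin m → E) :=
  {v | (∀ i, v i ∈ A) ∧ ∀ c : Fin m → F, ∑ i, c i • v i ∈ B → c = 0}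

theorem linearIndependent_of_mem_indepTuples {A B : Submodule F E} {m : ℕ} {v : Fin m → E}
    (hv : v ∈ indepTuples A B m) : LinearIndependent F v := by
  rw [Fintype.linearIndependent_iff]
  intro c hc i
  rw [hv.2 c (hc ▸ B.zero_mem)]
  rfl

theorem span_inf_eq_bot_of_mem_indepTuples {A B : Submodule F E} {m : ℕ} {v : Fin m → E}
    (hv : v ∈ indepTuples A B m) : B ⊓ Submodule.span F (Set.range v) = ⊥ := by
  rw [eq_bot_iff]
  rintro x ⟨hxB, hx⟩
  obtain ⟨c, rfl⟩ := (Submodule.mem_span_range_iff_exists_fun F).1 hx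
  rw [hv.2 c hxB]
  simp

theorem finrank_sup_span_of_mem_indepTuples [Module.Finite F E] {A B : Submodule F E} {m : ℕ}
    {v : Fin m → E} (hv : v ∈ indepTuples A B m) :
    Module.finrank F (B ⊔ Submodule.span F (Set.range v) : Submodule F E) =
      Module.finrank F B + m := by
  have h := Submodule.finrank_sup_add_finrank_inf_eq B (Submodule.span F (Set.range v))
  rw [span_inf_eq_bot_of_mem_indepTuples hv, finrank_bot,
    finrank_span_eq_card (linearIndependent_of_mem_indepTuples hv), Fintype.card_fin] at h
  simpa using h

theorem snoc_mem_indepTuples_iff {A B : Submodule F E} {m : ℕ} {v : Fin m → E} {x : E} :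
    (Fin.snoc v x : Fin (m + 1) → E) ∈ indepTuples A B (m + 1) ↔
      v ∈ indepTuples A B m ∧ x ∈ A ∧ x ∉ B ⊔ Submodule.span F (Set.range v) := by
  constructor
  · rintro ⟨h₁, h₂⟩
    refine ⟨⟨fun i => by simpa using h₁ i.castSucc, fun c hc => ?_⟩,
      by simpa using h₁ (Fin.last m), fun hx => ?_⟩
    · have := h₂ (Fin.snoc c 0 : Fin (m + 1) → F) (by simpa [Fin.sum_univ_castSucc] using hc)
      funext i
      simpa using congrFun this i.castSucc
    · obtain ⟨b, hb, y, hy, rfl⟩ := Submodule.mem_sup.1 hx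
      obtain ⟨c, rfl⟩ := (Submodule.mem_span_range_iff_exists_fun F).1 hy
      have := h₂ (Fin.snoc (-c) 1 : Fin (m + 1) → F) (by
        simpa [Fin.sum_univ_castSucc] using hb)
      simpa using congrFun this (Fin.last m)
  · rintro ⟨⟨h₁, h₂⟩, hxA, hx⟩
    refine ⟨fun i => ?_, fun c hc => ?_⟩
    · refine Fin.lastCases ?_ (fun j => ?_) i
      · simpa using hxA
      · simpa using h₁ j
    · rw [Fin.sum_univ_castSucc] at hc
      simp only [Fin.snoc_castSucc, Fin.snoc_last] at hc
      have h0 : c (Fin.last m) = 0 := by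
        by_contra h0
        apply hx
        have h3 : c (Fin.last m) • x ∈ B ⊔ Submodule.span F (Set.range v) := by
          have h4 : ∑ i : Fin m, c i.castSucc • v i ∈ Submodule.span F (Set.range v) :=
            Submodule.sum_mem _ fun i _ =>
              Submodule.smul_mem _ _ (Submodule.subset_span ⟨i, rfl⟩)
          have := Submodule.sub_mem _ (Submodule.mem_sup_left (T := Submodule.span F (Set.range v)) hc)
            (Submodule.mem_sup_right (S := B) h4)
          simpa using this
        exact (Submodule.smul_mem_iff _ h0).1 h3
      rw [h0, zero_smul, add_zero] at hc
      have := h₂ _ hc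
      funext i
      refine Fin.lastCases h0 (fun j => ?_) i
      exact congrFun this j

/-- The sum S₁ + S₂ is direct, so a combination of the a_i + b_i lying in T₁ ⊔ T₂ has its
S₁-component, the same combination of the a_i, in T₁. -/
theorem add_mem_indepTuples {S₁ S₂ T₁ T₂ : Submodule F E} (hS : S₁ ⊓ S₂ = ⊥) (h₁ : T₁ ≤ S₁)
    (h₂ : T₂ ≤ S₂) {t : ℕ} {a b : Fin t → E} (ha : a ∈ indepTuples S₁ T₁ t)
    (hb : b ∈ indepTuples S₂ T₂ t) : a + b ∈ indepTuples ⊤ (T₁ ⊔ T₂) t := by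
  refine ⟨fun _ => trivial, fun c hc => ha.2 c ?_⟩
  obtain ⟨p₁, hp₁, p₂, hp₂, hp⟩ := Submodule.mem_sup.1 hc
  simp only [Pi.add_apply, smul_add, Finset.sum_add_distrib] at hp
  have h0 : ∑ i, c i • a i - p₁ ∈ S₁ ⊓ S₂ := by
    refine ⟨Submodule.sub_mem _ (Submodule.sum_mem _ fun i _ => Submodule.smul_mem _ _ (ha.1 i))
      (h₁ hp₁), ?_⟩
    have : ∑ i, c i • a i - p₁ = p₂ - ∑ i, c i • b i := by
      rw [sub_eq_sub_iff_add_eq_add, ← hp, add_comm]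
    rw [this]
    exact Submodule.sub_mem _ (h₂ hp₂)
      (Submodule.sum_mem _ fun i _ => Submodule.smul_mem _ _ (hb.1 i))
  rw [hS, Submodule.mem_bot] at h0
  rw [sub_eq_zero.1 h0]
  exact hp₁

variable [Fintype F] [Finite E]

theorem ncard_submodule (V : Submodule F E) :
    (V : Set E).ncard = Fintype.card F ^ Module.finrank F V := by
  have := Fintype.ofFinite V
  rw [← Nat.card_coe_set_eq, ← Module.card_eq_pow_finrank (K := F) (V := V),
    ← Nat.card_eq_fintype_card]
  rfl

/-- The tuple grows by one vector at a time: after s vectors, the next one must avoid a subspace of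
dimension dim B + s. -/
theorem ncard_indepTuples {A B : Submodule F E} (h : B ≤ A) (m : ℕ) :
    ((indepTuples A B m).ncard : ℚ) = ∏ s ∈ Finset.range m,
      ((Fintype.card F : ℚ) ^ Module.finrank F A -
        (Fintype.card F : ℚ) ^ (Module.finrank F B + s)) := by
  have := Module.Finite.of_finite (R := F) (M := E)
  induction m with
  | zero =>
    have : indepTuples A B 0 = Set.univ :=
      Set.eq_univ_of_forall fun v => ⟨fun i => i.elim0, fun c _ => Subsingleton.elim _ _⟩
    simp [this]
  | succ m ih =>
    rw [Finset.prod_range_succ, ← ih]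
    refine ncard_eq_mul_of_fibers (f := fun w => Fin.init w) (fun w hw => ?_) (fun v hv => ?_)
    · rw [← Fin.snoc_init_self w] at hw
      exact (snoc_mem_indepTuples_iff.1 hw).1
    · have himg : {w | w ∈ indepTuples A B (m + 1) ∧ Fin.init w = v} =
          (fun x => (Fin.snoc v x : Fin (m + 1) → E)) ''
            ((A : Set E) \ (B ⊔ Submodule.span F (Set.range v) : Submodule F E)) := by
        ext w
        constructor
        · rintro ⟨hw, rfl⟩
          rw [← Fin.snoc_init_self w] at hw
          exact ⟨w (Fin.last m), (snoc_mem_indepTuples_iff.1 hw).2, Fin.snoc_init_self w⟩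
        · rintro ⟨x, hx, rfl⟩
          exact ⟨snoc_mem_indepTuples_iff.2 ⟨hv, hx⟩, by simp⟩
      have hle : B ⊔ Submodule.span F (Set.range v) ≤ A :=
        sup_le h (Submodule.span_le.2 (by rintro _ ⟨i, rfl⟩; exact hv.1 i))
      rw [himg, Set.ncard_image_of_injective _ (fun x y hxy => by
        simpa using congrFun hxy (Fin.last m)), Set.ncard_sdiff hle, Nat.cast_sub
        (Set.ncard_le_ncard hle), ncard_submodule, ncard_submodule,
        finrank_sup_span_of_mem_indepTuples hv]
      push_cast
      rfl

theorem prod_pow_sub_ne_zero {q : ℕ} (hq : 1 < q) (m : ℕ) :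
    ∏ s ∈ Finset.range m, ((q : ℚ) ^ m - (q : ℚ) ^ s) ≠ 0 := by
  rw [Finset.prod_ne_zero_iff]
  intro s hs
  have : (q : ℚ) ^ s < (q : ℚ) ^ m :=
    pow_lt_pow_right₀ (by exact_mod_cast hq) (Finset.mem_range.1 hs)
  exact (sub_pos.2 this).ne'

theorem prod_pow_add_sub (q : ℚ) (a b m : ℕ) :
    ∏ s ∈ Finset.range m, (q ^ (b + a) - q ^ (b + s)) =
      q ^ (b * m) * ∏ s ∈ Finset.range m, (q ^ a - q ^ s) := by
  simp_rw [pow_add q b, ← mul_sub, Finset.prod_mul_distrib, Finset.prod_const, Finset.card_range,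
    pow_mul]

/-- The number of `d`-dimensional subspaces that meet `S` in a given subspace `W`. -/
theorem ncard_inf_eq {S W : Submodule F E} (h : W ≤ S) {m : ℕ} :
    ({V : Submodule F E | Module.finrank F V = Module.finrank F W + m ∧ V ⊓ S = W}.ncard : ℚ) =
      (Fintype.card F : ℚ) ^ ((Module.finrank F S - Module.finrank F W) * m) *
        gaussBinom (Fintype.card F) (Module.finrank F E - Module.finrank F S) m := by
  have := Module.Finite.of_finite (R := F) (M := E)
  have hq : 1 < Fintype.card F := Fintype.one_lt_card
  -- Double count via v ↦ W ⊔ span v. The fiber over V consists of the tuples of V independent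
  -- modulo W: since V ⊓ S = W, these are also independent modulo S.
  have key := ncard_eq_mul_of_fibers (s := indepTuples ⊤ S m)
    (t := {V : Submodule F E | Module.finrank F V = Module.finrank F W + m ∧ V ⊓ S = W})
    (f := fun v => W ⊔ Submodule.span F (Set.range v))
    (N := ((Fintype.card F : ℚ) ^ (Module.finrank F W * m) *
      ∏ s ∈ Finset.range m, ((Fintype.card F : ℚ) ^ m - (Fintype.card F : ℚ) ^ s))) ?_ ?_
  · obtain ⟨b, hb⟩ := Nat.exists_eq_add_of_le (Submodule.finrank_le S)
    obtain ⟨c, hc⟩ := Nat.exists_eq_add_of_le (Submodule.finrank_mono h)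
    rw [ncard_indepTuples le_top, finrank_top, hb, prod_pow_add_sub] at key
    rw [hb, hc, gaussBinom]
    rw [hc] at key
    simp only [Nat.add_sub_cancel_left] at key ⊢
    have h1 := prod_pow_sub_ne_zero hq m
    have h2 : (Fintype.card F : ℚ) ^ (Module.finrank F W * m) ≠ 0 :=
      pow_ne_zero _ (by positivity)
    rw [← mul_div_assoc, eq_div_iff h1]
    apply mul_left_cancel₀ h2
    rw [add_mul, pow_add] at key
    linear_combination -key
  · intro v hv
    have hv' : v ∈ indepTuples ⊤ W m := ⟨hv.1, fun c hc => hv.2 c (h hc)⟩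
    refine ⟨finrank_sup_span_of_mem_indepTuples hv', ?_⟩
    rw [sup_inf_assoc_of_le _ h, inf_comm, span_inf_eq_bot_of_mem_indepTuples hv, sup_bot_eq]
  · rintro V ⟨hV, hVS⟩
    have hWV : W ≤ V := hVS ▸ inf_le_left
    rw [← prod_pow_add_sub, ← hV, ← ncard_indepTuples hWV]
    congr 2
    ext v
    constructor
    · rintro ⟨hv, rfl⟩
      exact ⟨fun i => Submodule.mem_sup_right (Submodule.subset_span ⟨i, rfl⟩),
        fun c hc => hv.2 c (h hc)⟩
    · intro hv
      refine ⟨⟨fun _ => trivial, fun c hc => hv.2 c ?_⟩, ?_⟩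
      · rw [← hVS]
        exact ⟨Submodule.sum_mem _ fun i _ => Submodule.smul_mem _ _ (hv.1 i), hc⟩
      · refine Submodule.eq_of_le_of_finrank_eq
          (sup_le hWV (Submodule.span_le.2 (by rintro _ ⟨i, rfl⟩; exact hv.1 i))) ?_
        rw [finrank_sup_span_of_mem_indepTuples hv, hV]

/-- This is `ncard_inf_eq` with both subspaces zero, in the ambient space S. -/
theorem ncard_le_finrank_eq (S : Submodule F E) (m : ℕ) :
    ({V : Submodule F E | V ≤ S ∧ Module.finrank F V = m}.ncard : ℚ) =
      gaussBinom (Fintype.card F) (Module.finrank F S) m := by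
  have h := ncard_inf_eq (F := F) (E := S) (S := ⊥) (W := ⊥) le_rfl (m := m)
  simp only [finrank_bot, zero_add, inf_bot_eq, and_true, tsub_zero, zero_mul, pow_zero,
    one_mul] at h
  rw [← h]
  congr 1
  have : {V : Submodule F E | V ≤ S ∧ Module.finrank F V = m} =
      Submodule.map S.subtype '' {V : Submodule F S | Module.finrank F V = m} := by
    ext V
    constructor
    · rintro ⟨hV, rfl⟩
      refine ⟨V.comap S.subtype, ?_, ?_⟩
      · rw [Set.mem_ofPred_eq, ← Submodule.finrank_map_subtype_eq, Submodule.map_comap_subtype,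
          inf_eq_right.2 hV]
      · rw [Submodule.map_comap_subtype, inf_eq_right.2 hV]
    · rintro ⟨V, rfl, rfl⟩
      exact ⟨Submodule.map_subtype_le S V, Submodule.finrank_map_subtype_eq S V⟩
  rw [this, Set.ncard_image_of_injective _
    (Submodule.map_injective_of_injective S.injective_subtype)]

/-- The number of subspaces of `S₁ ⊔ S₂` that meet the two summands in given subspaces. -/
theorem ncard_le_sup_inf_eq {S₁ S₂ T₁ T₂ : Submodule F E} (hS : S₁ ⊓ S₂ = ⊥) (h₁ : T₁ ≤ S₁)
    (h₂ : T₂ ≤ S₂) (t : ℕ) :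
    ({W : Submodule F E | W ≤ S₁ ⊔ S₂ ∧ W ⊓ S₁ = T₁ ∧ W ⊓ S₂ = T₂ ∧
      Module.finrank F W = Module.finrank F T₁ + Module.finrank F T₂ + t}.ncard : ℚ) =
      (∏ s ∈ Finset.range t, ((Fintype.card F : ℚ) ^ t - (Fintype.card F : ℚ) ^ s)) *
        gaussBinom (Fintype.card F) (Module.finrank F S₁ - Module.finrank F T₁) t *
        gaussBinom (Fintype.card F) (Module.finrank F S₂ - Module.finrank F T₂) t := by
  have := Module.Finite.of_finite (R := F) (M := E)
  have hq : 1 < Fintype.card F := Fintype.one_lt_card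
  have hzero : ∀ x, x ∈ S₁ → x ∈ S₂ → x = 0 := fun x hx hy => by
    have : x ∈ S₁ ⊓ S₂ := ⟨hx, hy⟩
    rwa [hS, Submodule.mem_bot] at this
  have hT : Module.finrank F (T₁ ⊔ T₂ : Submodule F E) =
      Module.finrank F T₁ + Module.finrank F T₂ := by
    have h := Submodule.finrank_sup_add_finrank_inf_eq T₁ T₂
    rwa [eq_bot_iff.2 ((inf_le_inf h₁ h₂).trans hS.le), finrank_bot, add_zero] at h
  have hsum : ∀ {S : Submodule F E} {a : Fin t → E} (_ : ∀ i, a i ∈ S) (c : Fin t → F),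
      ∑ i, c i • a i ∈ S := fun ha c =>
    Submodule.sum_mem _ fun i _ => Submodule.smul_mem _ _ (ha i)
  -- The sums a_i + b_i span the graph part of W. The fiber over W is in bijection with the tuples
  -- of W independent modulo T₁ ⊔ T₂, each splitting uniquely into its S₁- and S₂-components.
  have key := ncard_eq_mul_of_fibers (s := indepTuples S₁ T₁ t ×ˢ indepTuples S₂ T₂ t)
    (t := {W : Submodule F E | W ≤ S₁ ⊔ S₂ ∧ W ⊓ S₁ = T₁ ∧ W ⊓ S₂ = T₂ ∧
      Module.finrank F W = Module.finrank F T₁ + Module.finrank F T₂ + t})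
    (f := fun v => T₁ ⊔ T₂ ⊔ Submodule.span F (Set.range (v.1 + v.2)))
    (N := (Fintype.card F : ℚ) ^ ((Module.finrank F T₁ + Module.finrank F T₂) * t) *
      ∏ s ∈ Finset.range t, ((Fintype.card F : ℚ) ^ t - (Fintype.card F : ℚ) ^ s)) ?_ ?_
  · obtain ⟨b, hb⟩ := Nat.exists_eq_add_of_le (Submodule.finrank_mono h₁)
    obtain ⟨c, hc⟩ := Nat.exists_eq_add_of_le (Submodule.finrank_mono h₂)
    rw [Set.ncard_prod, Nat.cast_mul, ncard_indepTuples h₁, ncard_indepTuples h₂, hb, hc,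
      prod_pow_add_sub, prod_pow_add_sub] at key
    rw [hb, hc, gaussBinom, gaussBinom]
    simp only [Nat.add_sub_cancel_left] at key ⊢
    have h1 := prod_pow_sub_ne_zero hq t
    have h2 : (Fintype.card F : ℚ) ^ ((Module.finrank F T₁ + Module.finrank F T₂) * t) ≠ 0 :=
      pow_ne_zero _ (by positivity)
    rw [mul_div_cancel₀ _ h1, ← mul_div_assoc, eq_div_iff h1]
    apply mul_left_cancel₀ h2
    rw [add_mul, pow_add] at key ⊢
    linear_combination -key
  · rintro ⟨a, b⟩ ⟨ha, hb⟩
    have hdec : ∀ x ∈ T₁ ⊔ T₂ ⊔ Submodule.span F (Set.range (a + b)), ∃ p₁ ∈ T₁, ∃ p₂ ∈ T₂,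
        ∃ c : Fin t → F, (p₁ + ∑ i, c i • a i) + (p₂ + ∑ i, c i • b i) = x := by
      intro x hx
      obtain ⟨p, hp, y, hy, rfl⟩ := Submodule.mem_sup.1 hx
      obtain ⟨p₁, hp₁, p₂, hp₂, rfl⟩ := Submodule.mem_sup.1 hp
      obtain ⟨c, rfl⟩ := (Submodule.mem_span_range_iff_exists_fun F).1 hy
      refine ⟨p₁, hp₁, p₂, hp₂, c, ?_⟩
      simp only [Pi.add_apply, smul_add, Finset.sum_add_distrib]
      abel
    have hab := add_mem_indepTuples hS h₁ h₂ ha hb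
    refine ⟨?_, ?_, ?_, ?_⟩
    · intro x hx
      obtain ⟨p₁, hp₁, p₂, hp₂, c, rfl⟩ := hdec x hx
      exact Submodule.add_mem_sup (Submodule.add_mem _ (h₁ hp₁) (hsum ha.1 c))
        (Submodule.add_mem _ (h₂ hp₂) (hsum hb.1 c))
    · refine le_antisymm ?_ (le_inf (le_sup_left.trans le_sup_left) h₁)
      rintro x ⟨hx, hxS⟩
      obtain ⟨p₁, hp₁, p₂, hp₂, c, rfl⟩ := hdec x hx
      -- An element of S₁ has zero S₂-component; independence of b modulo T₂ then kills c.
      have h0 : p₂ + ∑ i, c i • b i = 0 := by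
        refine hzero _ ?_ (Submodule.add_mem _ (h₂ hp₂) (hsum hb.1 c))
        exact (Submodule.add_mem_iff_right _ (Submodule.add_mem _ (h₁ hp₁) (hsum ha.1 c))).1 hxS
      have hc : c = 0 := hb.2 c (by
        rw [← neg_eq_of_add_eq_zero_right h0]; exact Submodule.neg_mem _ hp₂)
      rw [h0, hc]
      simpa using hp₁
    · refine le_antisymm ?_ (le_inf (le_sup_right.trans le_sup_left) h₂)
      rintro x ⟨hx, hxS⟩
      obtain ⟨p₁, hp₁, p₂, hp₂, c, rfl⟩ := hdec x hx
      have h0 : p₁ + ∑ i, c i • a i = 0 := by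
        refine hzero _ (Submodule.add_mem _ (h₁ hp₁) (hsum ha.1 c)) ?_
        exact (Submodule.add_mem_iff_left _ (Submodule.add_mem _ (h₂ hp₂) (hsum hb.1 c))).1 hxS
      have hc : c = 0 := ha.2 c (by
        rw [← neg_eq_of_add_eq_zero_right h0]; exact Submodule.neg_mem _ hp₁)
      rw [h0, hc]
      simpa using hp₂
    · rw [finrank_sup_span_of_mem_indepTuples hab, hT]
  · rintro W ⟨hW, hW₁, hW₂, hWt⟩
    have hT₁ : T₁ ≤ W := hW₁ ▸ inf_le_left
    have hT₂ : T₂ ≤ W := hW₂ ▸ inf_le_left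
    rw [← hT, ← prod_pow_add_sub, hT, ← hWt, ← hT, ← ncard_indepTuples (sup_le hT₁ hT₂)]
    congr 1
    refine Set.ncard_congr (fun v _ => v.1 + v.2) ?_ ?_ ?_
    · rintro ⟨a, b⟩ ⟨⟨ha, hb⟩, rfl⟩
      refine ⟨fun i => Submodule.mem_sup_right (Submodule.subset_span ⟨i, rfl⟩),
        (add_mem_indepTuples hS h₁ h₂ ha hb).2⟩
    · rintro ⟨a, b⟩ ⟨a', b'⟩ ⟨⟨ha, hb⟩, -⟩ ⟨⟨ha', hb'⟩, -⟩ hv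
      have h0 : ∀ i, a i - a' i = 0 := fun i => by
        refine hzero _ (Submodule.sub_mem _ (ha.1 i) (ha'.1 i)) ?_
        have : a i - a' i = b' i - b i := by
          rw [sub_eq_sub_iff_add_eq_add, add_comm (b' i)]
          exact congrFun hv i
        rw [this]
        exact Submodule.sub_mem _ (hb'.1 i) (hb.1 i)
      have haa : a = a' := funext fun i => sub_eq_zero.1 (h0 i)
      subst haa
      simpa using hv
    · intro v hv
      choose a ha b hb hab using fun i => Submodule.mem_sup.1 (hW (hv.1 i))
      have hadd : a + b = v := funext hab
      refine ⟨(a, b), ⟨⟨⟨ha, fun c hc => hv.2 c ?_⟩, hb, fun c hc => hv.2 c ?_⟩, ?_⟩, hadd⟩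
      -- If ∑ c_i a_i lies in T₁ ≤ W, then ∑ c_i b_i lies in W ⊓ S₂ = T₂, so independence of v = a +
      -- b applies.
      · have hcv := hsum hv.1 c
        rw [← hadd] at hcv ⊢
        simp only [Pi.add_apply, smul_add, Finset.sum_add_distrib] at hcv ⊢
        refine Submodule.add_mem_sup hc ?_
        rw [← hW₂]
        exact ⟨(Submodule.add_mem_iff_right _ (hT₁ hc)).1 hcv, hsum hb c⟩
      · have hcv := hsum hv.1 c
        rw [← hadd] at hcv ⊢
        simp only [Pi.add_apply, smul_add, Finset.sum_add_distrib] at hcv ⊢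
        refine Submodule.add_mem_sup ?_ hc
        rw [← hW₁]
        exact ⟨(Submodule.add_mem_iff_left _ (hT₂ hc)).1 hcv, hsum ha c⟩
      · refine Submodule.eq_of_le_of_finrank_eq (sup_le (sup_le hT₁ hT₂) (Submodule.span_le.2
          (by rintro _ ⟨i, rfl⟩; exact (hab i ▸ hv.1 i : a i + b i ∈ W)))) ?_
        rw [show ((a, b) : (Fin t → E) × (Fin t → E)).1 + (a, b).2 = v from hadd,
          finrank_sup_span_of_mem_indepTuples hv, hT, hWt]

end Counting

/-! ### Subspaces with prescribed intersection dimensions -/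

section Counting

variable {F E : Type*} [Field F] [AddCommGroup E] [Module F E]

theorem finrank_sup_of_inf_eq_bot [Module.Finite F E] {S₁ S₂ : Submodule F E}
    (hS : S₁ ⊓ S₂ = ⊥) : Module.finrank F (S₁ ⊔ S₂ : Submodule F E) =
      Module.finrank F S₁ + Module.finrank F S₂ := by
  have h := Submodule.finrank_sup_add_finrank_inf_eq S₁ S₂
  rwa [hS, finrank_bot, add_zero] at h

/-- These inequalities confine the excess t = dim(V ∩ (S₁ ⊕ S₂)) - t₁ - t₂ to the summation range of
N: projecting V ∩ (S₁ ⊕ S₂) to S₁ has kernel V ∩ S₂, and symmetrically. -/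
theorem finrank_inf_sup_bounds [Module.Finite F E] {S₁ S₂ : Submodule F E} (hS : S₁ ⊓ S₂ = ⊥)
    (V : Submodule F E) :
    Module.finrank F (V ⊓ S₁ : Submodule F E) + Module.finrank F (V ⊓ S₂ : Submodule F E) ≤
        Module.finrank F (V ⊓ (S₁ ⊔ S₂) : Submodule F E) ∧
      Module.finrank F (V ⊓ (S₁ ⊔ S₂) : Submodule F E) ≤
        Module.finrank F S₁ + Module.finrank F (V ⊓ S₂ : Submodule F E) ∧
      Module.finrank F (V ⊓ (S₁ ⊔ S₂) : Submodule F E) ≤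
        Module.finrank F S₂ + Module.finrank F (V ⊓ S₁ : Submodule F E) := by
  have hbot : V ⊓ S₁ ⊓ (V ⊓ S₂) = ⊥ :=
    eq_bot_iff.2 ((inf_le_inf inf_le_right inf_le_right).trans hS.le)
  have hsup := finrank_sup_of_inf_eq_bot hS
  refine ⟨?_, ?_, ?_⟩
  · rw [← finrank_sup_of_inf_eq_bot hbot]
    exact Submodule.finrank_mono (sup_le (inf_le_inf le_rfl le_sup_left)
      (inf_le_inf le_rfl le_sup_right))
  · have h := Submodule.finrank_sup_add_finrank_inf_eq (V ⊓ (S₁ ⊔ S₂)) S₂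
    have h' : Module.finrank F (V ⊓ (S₁ ⊔ S₂) ⊔ S₂ : Submodule F E) ≤
        Module.finrank F (S₁ ⊔ S₂ : Submodule F E) :=
      Submodule.finrank_mono (sup_le inf_le_right le_sup_right)
    rw [inf_assoc, inf_eq_right.2 (le_sup_right : S₂ ≤ S₁ ⊔ S₂)] at h
    omega
  · have h := Submodule.finrank_sup_add_finrank_inf_eq (V ⊓ (S₁ ⊔ S₂)) S₁
    have h' : Module.finrank F (V ⊓ (S₁ ⊔ S₂) ⊔ S₁ : Submodule F E) ≤
        Module.finrank F (S₁ ⊔ S₂ : Submodule F E) :=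
      Submodule.finrank_mono (sup_le inf_le_right le_sup_left)
    rw [inf_assoc, inf_eq_right.2 (le_sup_left : S₁ ≤ S₁ ⊔ S₂)] at h
    omega

variable [Fintype F] [Finite E]

theorem ncard_le_sup_finrank_inf {S₁ S₂ : Submodule F E} (hS : S₁ ⊓ S₂ = ⊥) (t t₁ t₂ : ℕ) :
    ({W : Submodule F E | W ≤ S₁ ⊔ S₂ ∧ Module.finrank F (W ⊓ S₁ : Submodule F E) = t₁ ∧
      Module.finrank F (W ⊓ S₂ : Submodule F E) = t₂ ∧
      Module.finrank F W = t₁ + t₂ + t}.ncard : ℚ) =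
      subspaceNt (Fintype.card F) t (Module.finrank F S₁) (Module.finrank F S₂) t₁ t₂ := by
  rw [ncard_eq_mul_of_fibers
    (t := {T | T ≤ S₁ ∧ Module.finrank F T = t₁} ×ˢ {T | T ≤ S₂ ∧ Module.finrank F T = t₂})
    (f := fun W => (W ⊓ S₁, W ⊓ S₂))
    (N := (∏ s ∈ Finset.range t, ((Fintype.card F : ℚ) ^ t - (Fintype.card F : ℚ) ^ s)) *
        gaussBinom (Fintype.card F) (Module.finrank F S₁ - t₁) t *
        gaussBinom (Fintype.card F) (Module.finrank F S₂ - t₂) t),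
    Set.ncard_prod, Nat.cast_mul, ncard_le_finrank_eq, ncard_le_finrank_eq, subspaceNt]
  · ring
  · rintro W ⟨-, h₁, h₂, -⟩
    exact ⟨⟨inf_le_right, h₁⟩, inf_le_right, h₂⟩
  · rintro ⟨T₁, T₂⟩ ⟨⟨h₁, rfl⟩, h₂, rfl⟩
    rw [← ncard_le_sup_inf_eq hS h₁ h₂]
    congr 2
    ext W
    simp only [Set.mem_ofPred_eq, Prod.mk.injEq]
    constructor
    · rintro ⟨⟨hW, -, -, hd⟩, rfl, rfl⟩
      exact ⟨hW, rfl, rfl, hd⟩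
    · rintro ⟨hW, rfl, rfl, hd⟩
      exact ⟨⟨hW, rfl, rfl, hd⟩, rfl, rfl⟩

/-- The number of `d`-dimensional subspaces whose intersections with `S₁`, `S₂` and `S₁ ⊔ S₂`
have given dimensions. -/
theorem ncard_finrank_inf_sup {S₁ S₂ : Submodule F E} (hS : S₁ ⊓ S₂ = ⊥) (t t₁ t₂ m : ℕ) :
    ({V : Submodule F E | Module.finrank F V = t₁ + t₂ + t + m ∧
      Module.finrank F (V ⊓ S₁ : Submodule F E) = t₁ ∧
      Module.finrank F (V ⊓ S₂ : Submodule F E) = t₂ ∧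
      Module.finrank F (V ⊓ (S₁ ⊔ S₂) : Submodule F E) = t₁ + t₂ + t}.ncard : ℚ) =
    subspaceNt (Fintype.card F) t (Module.finrank F S₁) (Module.finrank F S₂) t₁ t₂ *
      ((Fintype.card F : ℚ) ^ ((Module.finrank F S₁ + Module.finrank F S₂ - (t₁ + t₂ + t)) * m) *
        gaussBinom (Fintype.card F)
          (Module.finrank F E - (Module.finrank F S₁ + Module.finrank F S₂)) m) := by
  have := Module.Finite.of_finite (R := F) (M := E)
  have e₁ : ∀ V : Submodule F E, V ⊓ (S₁ ⊔ S₂) ⊓ S₁ = V ⊓ S₁ := fun V => by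
    rw [inf_assoc, inf_eq_right.2 (le_sup_left : S₁ ≤ S₁ ⊔ S₂)]
  have e₂ : ∀ V : Submodule F E, V ⊓ (S₁ ⊔ S₂) ⊓ S₂ = V ⊓ S₂ := fun V => by
    rw [inf_assoc, inf_eq_right.2 (le_sup_right : S₂ ≤ S₁ ⊔ S₂)]
  rw [← ncard_le_sup_finrank_inf hS]
  refine ncard_eq_mul_of_fibers (f := fun V => V ⊓ (S₁ ⊔ S₂)) ?_ ?_
  · rintro V ⟨-, h₁, h₂, h⟩
    exact ⟨inf_le_right, by rw [e₁, h₁], by rw [e₂, h₂], h⟩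
  · rintro W ⟨hW, h₁, h₂, hd⟩
    rw [← finrank_sup_of_inf_eq_bot hS, ← hd, ← ncard_inf_eq hW]
    congr 2
    ext V
    constructor
    · rintro ⟨⟨h, -⟩, hV⟩
      exact ⟨h, hV⟩
    · rintro ⟨h, hV⟩
      refine ⟨⟨h, ?_, ?_, by rw [hV]⟩, hV⟩
      · rw [← e₁, hV, h₁]
      · rw [← e₂, hV, h₂]

/-- The number of `d`-dimensional subspaces whose intersections with two independent subspaces
have given dimensions. -/
theorem ncard_finrank_inf {S₁ S₂ : Submodule F E} (hS : S₁ ⊓ S₂ = ⊥) (d t₁ t₂ : ℕ) :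
    ({V : Submodule F E | Module.finrank F V = d ∧
      Module.finrank F (V ⊓ S₁ : Submodule F E) = t₁ ∧
      Module.finrank F (V ⊓ S₂ : Submodule F E) = t₂}.ncard : ℚ) =
    subspaceN (Fintype.card F) (Module.finrank F E) d (Module.finrank F S₁)
      (Module.finrank F S₂) t₁ t₂ := by
  classical
  have := Module.Finite.of_finite (R := F) (M := E)
  have := Fintype.ofFinite (Submodule F E)
  rw [Set.ncard_eq_toFinset_card', Finset.card_eq_sum_card_fiberwise
    (f := fun V => Module.finrank F (V ⊓ (S₁ ⊔ S₂) : Submodule F E) - t₁ - t₂)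
    (t := Finset.range (min (Module.finrank F S₁ - t₁) (Module.finrank F S₂ - t₂) + 1)), subspaceN,
    Nat.cast_sum]
  · refine Finset.sum_congr rfl fun t _ => ?_
    have hset : (({V ∈ {V : Submodule F E | Module.finrank F V = d ∧
        Module.finrank F (V ⊓ S₁ : Submodule F E) = t₁ ∧
        Module.finrank F (V ⊓ S₂ : Submodule F E) = t₂}.toFinset |
          Module.finrank F (V ⊓ (S₁ ⊔ S₂) : Submodule F E) - t₁ - t₂ = t} : Finset _) :
            Set (Submodule F E)) =
        {V : Submodule F E | Module.finrank F V = d ∧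
          Module.finrank F (V ⊓ S₁ : Submodule F E) = t₁ ∧
          Module.finrank F (V ⊓ S₂ : Submodule F E) = t₂ ∧
          Module.finrank F (V ⊓ (S₁ ⊔ S₂) : Submodule F E) = t₁ + t₂ + t} := by
      ext V
      -- The lower bound t₁ + t₂ makes the truncated subtraction exact.
      have := finrank_inf_sup_bounds hS V
      simp only [Finset.coe_filter, Set.mem_toFinset, Set.mem_ofPred_eq]
      constructor
      · rintro ⟨⟨h, h₁, h₂⟩, h₃⟩
        exact ⟨h, h₁, h₂, by omega⟩
      · rintro ⟨h, h₁, h₂, h₃⟩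
        exact ⟨⟨h, h₁, h₂⟩, by omega⟩
    rw [← Set.ncard_coe_finset, hset]
    split_ifs with h
    · obtain ⟨m, rfl⟩ := Nat.exists_eq_add_of_le h
      rw [show t + t₁ + t₂ + m = t₁ + t₂ + t + m by ring, ncard_finrank_inf_sup hS,
        show t₁ + t₂ + t + m - t - t₁ - t₂ = m by omega,
        Nat.sub_sub (Module.finrank F E), Nat.sub_sub (_ - t), Nat.sub_sub _ t, add_comm t]
      ring
    · rw [Nat.cast_eq_zero, Set.ncard_eq_zero, Set.eq_empty_iff_forall_notMem]
      rintro V ⟨hd, -, -, hV⟩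
      have : Module.finrank F (V ⊓ (S₁ ⊔ S₂) : Submodule F E) ≤ Module.finrank F V :=
        Submodule.finrank_mono inf_le_left
      omega
  · intro V hV
    obtain ⟨-, h₁, h₂⟩ := by simpa using hV
    have := finrank_inf_sup_bounds hS V
    simp only [Finset.coe_range, Set.mem_Iio]
    omega

/-! ### Vectors outside the union, and sums of two powers -/

theorem ncard_diff_union_add {S₁ S₂ : Submodule F E} (hS : S₁ ⊓ S₂ = ⊥) (V : Submodule F E) :
    ((V : Set E) ∩ {v | v ∉ (S₁ : Set E) ∪ (S₂ : Set E)}).ncard +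
      Fintype.card F ^ Module.finrank F (V ⊓ S₁ : Submodule F E) +
      Fintype.card F ^ Module.finrank F (V ⊓ S₂ : Submodule F E) =
      Fintype.card F ^ Module.finrank F V + 1 := by
  have hinter : ((V ⊓ S₁ : Submodule F E) : Set E) ∩ (V ⊓ S₂ : Submodule F E) = {0} := by
    rw [← Submodule.coe_inf, eq_bot_iff.2 ((inf_le_inf inf_le_right inf_le_right).trans hS.le),
      Submodule.bot_coe]
  have hunion := Set.ncard_union_add_ncard_inter ((V ⊓ S₁ : Submodule F E) : Set E)
    (V ⊓ S₂ : Submodule F E)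
  rw [hinter, Set.ncard_singleton, ncard_submodule, ncard_submodule] at hunion
  have hdiff := Set.ncard_sdiff_add_ncard_of_subset (s := ((V ⊓ S₁ : Submodule F E) : Set E) ∪
    (V ⊓ S₂ : Submodule F E)) (t := (V : Set E))
    (Set.union_subset (inf_le_left : V ⊓ S₁ ≤ V) (inf_le_left : V ⊓ S₂ ≤ V))
  rw [ncard_submodule] at hdiff
  have hset : (V : Set E) ∩ {v | v ∉ (S₁ : Set E) ∪ (S₂ : Set E)} =
      (V : Set E) \ (((V ⊓ S₁ : Submodule F E) : Set E) ∪ (V ⊓ S₂ : Submodule F E)) := by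
    ext x
    simp only [Set.mem_inter_iff, Set.mem_ofPred_eq, Set.mem_union, SetLike.mem_coe, Set.mem_sdiff,
      Submodule.mem_inf]
    tauto
  rw [hset]
  omega

/-- The larger exponent is determined: if a ≤ b < d, then q^a + q^b ≤ 2q^b ≤ q^{b+1} ≤ q^d < q^c +
q^d. This covers q = 2. -/
theorem pow_add_pow_inj {q : ℕ} (hq : 1 < q) {a b c d : ℕ} (h : q ^ a + q ^ b = q ^ c + q ^ d) :
    (a = c ∧ b = d) ∨ (a = d ∧ b = c) := by
  have key : ∀ {a b c d : ℕ}, a ≤ b → q ^ a + q ^ b = q ^ c + q ^ d → d ≤ b := by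
    intro a b c d hab h
    by_contra! hbd
    have h1 : q ^ a ≤ q ^ b := Nat.pow_le_pow_right (by omega) hab
    have h2 : q ^ (b + 1) ≤ q ^ d := Nat.pow_le_pow_right (by omega) hbd
    have h3 : 2 * q ^ b ≤ q ^ (b + 1) := by rw [pow_succ']; exact Nat.mul_le_mul_right _ hq
    have h4 : 0 < q ^ c := by positivity
    omega
  have inj : ∀ {a b : ℕ}, q ^ a = q ^ b → a = b := fun h => Nat.pow_right_injective hq h
  have main : ∀ {a b c d : ℕ}, a ≤ b → c ≤ d → q ^ a + q ^ b = q ^ c + q ^ d →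
      a = c ∧ b = d := by
    intro a b c d hab hcd h
    obtain rfl : b = d := le_antisymm (key hcd h.symm) (key hab h)
    exact ⟨inj (by omega), rfl⟩
  rcases le_total a b with hab | hab <;> rcases le_total c d with hcd | hcd
  · exact .inl (main hab hcd h)
  · exact .inr (main hab hcd (by omega))
  · exact .inr (main hab hcd (by omega)).symm
  · exact .inl (main hab hcd (by omega)).symm

end Counting

/-! ### Spanning columns, and codewords as linear maps -/

section Code

/-- Outside the exceptional case, the vectors avoiding `S₁ ∪ S₂` span the whole space. -/
theorem eq_top_of_compl_union_subset {F E : Type*} [Field F] [AddCommGroup E] [Module F E]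
    [Fintype F] [Finite E] {S₁ S₂ : Submodule F E} (hS : S₁ ⊓ S₂ = ⊥)
    (hex : ¬ (Fintype.card F = 2 ∧ Module.finrank F E = 2 ∧ Module.finrank F S₁ = 1 ∧
      Module.finrank F S₂ = 1))
    (hne : {v : E | v ∉ (S₁ : Set E) ∪ (S₂ : Set E)}.Nonempty) {V : Submodule F E}
    (hV : {v : E | v ∉ (S₁ : Set E) ∪ (S₂ : Set E)} ⊆ V) : V = ⊤ := by
  have := Module.Finite.of_finite (R := F) (M := E)
  have hq : 1 < Fintype.card F := Fintype.one_lt_card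
  by_contra hVtop
  obtain ⟨x, hx⟩ := hne
  have hx₁ : S₁ ≠ ⊤ := fun h => hx (Or.inl (by simp [h]))
  have hx₂ : S₂ ≠ ⊤ := fun h => hx (Or.inr (by simp [h]))
  have hcV := ncard_diff_union_add hS V
  have hcT := ncard_diff_union_add hS ⊤
  have hv := Submodule.finrank_lt hVtop
  have hu₁ := Submodule.finrank_lt hx₁
  have hu₂ := Submodule.finrank_lt hx₂
  have ht₁ := Submodule.finrank_sup_add_finrank_inf_eq V S₁
  have ht₂ := Submodule.finrank_sup_add_finrank_inf_eq V S₂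
  have hs₁ := Submodule.finrank_le (V ⊔ S₁)
  have hs₂ := Submodule.finrank_le (V ⊔ S₂)
  have hsum := Submodule.finrank_le (S₁ ⊔ S₂)
  rw [finrank_sup_of_inf_eq_bot hS] at hsum
  rw [Set.inter_eq_right.2 hV] at hcV
  rw [Submodule.top_coe, Set.univ_inter, top_inf_eq, top_inf_eq, finrank_top] at hcT
  generalize Module.finrank F (V ⊓ S₁ : Submodule F E) = t₁ at *
  generalize Module.finrank F (V ⊓ S₂ : Submodule F E) = t₂ at *
  generalize Module.finrank F (V ⊔ S₁ : Submodule F E) = s₁ at *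
  generalize Module.finrank F (V ⊔ S₂ : Submodule F E) = s₂ at *
  generalize Module.finrank F S₁ = u₁ at *
  generalize Module.finrank F S₂ = u₂ at *
  generalize Module.finrank F V = v at *
  generalize Module.finrank F E = k at *
  generalize Fintype.card F = q at *
  obtain ⟨K, rfl⟩ : ∃ K, k = K + 1 := ⟨k - 1, by omega⟩
  have mono : ∀ {a b : ℕ}, a ≤ b → q ^ a ≤ q ^ b := fun h => Nat.pow_le_pow_right (by omega) h
  have p₁ : 0 < q ^ t₁ := by positivity
  have p₂ : 0 < q ^ t₂ := by positivity
  have a₁ := mono (Nat.lt_succ_iff.1 hu₁)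
  have a₂ := mono (Nat.lt_succ_iff.1 hu₂)
  have a₃ := mono (Nat.lt_succ_iff.1 hv)
  -- The two counts give q^{K+1} + q^{t₁} + q^{t₂} = q^v + q^{u₁} + q^{u₂}. The right side is at
  -- most 3q^K, which is absurd for q ≥ 3.
  rcases Nat.lt_or_ge 2 q with h3 | h3
  · have := Nat.mul_le_mul_right (q ^ K) h3
    rw [← pow_succ'] at this
    simp only [Nat.succ_eq_add_one] at *
    omega
  obtain rfl : q = 2 := by omega
  rw [pow_succ'] at hcT
  obtain rfl | ⟨J, rfl⟩ : K = 0 ∨ ∃ J, K = J + 1 := by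
    rcases K with _ | J
    · exact .inl rfl
    · exact .inr ⟨J, rfl⟩
  · simp only [pow_zero] at a₁ a₂ a₃ hcT
    obtain rfl : u₁ = 0 := by omega
    obtain rfl : u₂ = 0 := by omega
    omega
  -- Two independent hyperplanes exist only in dimension 2 here, which for q = 2 is the excluded
  -- case.
  have hu : u₁ ≤ J ∨ u₂ ≤ J := by omega
  rw [pow_succ'] at a₁ a₂ a₃ hcT
  have hJ : 2 ^ u₁ + 2 ^ u₂ ≤ 3 * 2 ^ J := by
    rcases hu with h | h <;> have := mono h <;> omega
  by_cases hvJ : v ≤ J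
  · have := mono hvJ
    omega
  -- Now V is a hyperplane, so each 2^{u_r} - 2^{t_r} is at most half of 2^{u_r}; together they stay
  -- below the required 2·2^J.
  · have b₁ := mono (show u₁ ≤ t₁ + 1 by omega)
    have b₂ := mono (show u₂ ≤ t₂ + 1 by omega)
    rw [pow_succ'] at b₁ b₂
    omega

variable {F L : Type*} [Field F] [Field L] [Algebra F L]

/-- The codewords of the lifted code are the values at the columns of the linear maps to `L`. -/
theorem mem_liftedCode_iff {k n : ℕ} {G : Matrix (Fin k) (Fin n) F} {c : Fin n → L} :
    c ∈ liftedCode L G ↔ ∃ φ : (Fin k → F) →ₗ[F] L, (fun m => φ (fun a => G a m)) = c := by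
  rw [liftedCode, rowCode, Submodule.mem_span_range_iff_exists_fun]
  constructor
  · rintro ⟨x, rfl⟩
    refine ⟨Fintype.linearCombination F x, funext fun m => ?_⟩
    simp [Fintype.linearCombination_apply, Finset.sum_apply, Algebra.smul_def, mul_comm]
  · rintro ⟨φ, rfl⟩
    classical
    refine ⟨fun a => φ (fun j => if a = j then 1 else 0), funext fun m => ?_⟩
    rw [LinearMap.pi_apply_eq_sum_univ φ]
    simp [Finset.sum_apply, Algebra.smul_def, mul_comm]

theorem hammingNorm_add_ncard_zeros {K : Type*} [Zero K] [DecidableEq K] {n : ℕ}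
    (c : Fin n → K) : {m | c m = 0}.ncard + hammingNorm c = n := by
  rw [hammingNorm, Set.ncard_eq_toFinset_card', Set.toFinset_ofPred,
    Finset.card_filter_add_card_filter_not, Finset.card_univ, Fintype.card_fin]

variable [Fintype F] [Fintype L]

/-- The number of linear maps to `L` with a given kernel of codimension `j`. -/
theorem ncard_ker_eq {E : Type*} [AddCommGroup E] [Module F E] [Finite E] {V : Submodule F E}
    {j : ℕ} (hV : Module.finrank F V + j = Module.finrank F E) :
    ({φ : E →ₗ[F] L | LinearMap.ker φ = V}.ncard : ℚ) =
      ∏ s ∈ Finset.range j, ((Fintype.card L : ℚ) - (Fintype.card F : ℚ) ^ s) := by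
  have := Module.Finite.of_finite (R := F) (M := E)
  have hj : Module.finrank F (E ⧸ V) = j := by
    have := Submodule.finrank_quotient_add_finrank V
    omega
  let b : Module.Basis (Fin j) F (E ⧸ V) := Module.finBasisOfFinrankEq F _ hj
  have happ : ∀ (v : Fin j → L) (x : E), (b.constr F v ∘ₗ V.mkQ) x =
      ∑ i, b.repr (V.mkQ x) i • v i := fun v x => by
    rw [LinearMap.comp_apply, Module.Basis.constr_apply_fintype]
    rfl
  have hcount := ncard_indepTuples (F := F) (A := (⊤ : Submodule F L)) (B := ⊥) bot_le j
  rw [finrank_bot, finrank_top] at hcount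
  simp only [zero_add] at hcount
  rw [Module.card_eq_pow_finrank (K := F) (V := L), Nat.cast_pow, ← hcount, Nat.cast_inj]
  symm
  -- A map with kernel V is an embedding of E/V, given by the independent images of a basis.
  refine Set.ncard_congr (fun v _ => b.constr F v ∘ₗ V.mkQ) ?_ ?_ ?_
  · rintro v ⟨-, hv⟩
    ext x
    rw [LinearMap.mem_ker, happ]
    constructor
    · intro h
      have h0 : b.repr (V.mkQ x) = 0 := DFunLike.coe_injective (hv _ ((Submodule.mem_bot F).2 h))
      rwa [map_eq_zero_iff _ b.repr.injective, Submodule.mkQ_apply,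
        Submodule.Quotient.mk_eq_zero] at h0
    · intro h
      rw [Submodule.mkQ_apply, (Submodule.Quotient.mk_eq_zero V).2 h]
      simp
  · intro v w _ _ h
    exact (b.constr F).injective ((LinearMap.cancel_right V.mkQ_surjective).1 h)
  · rintro φ rfl
    have hφ : b.constr F (fun i => (LinearMap.ker φ).liftQ φ le_rfl (b i)) ∘ₗ
        (LinearMap.ker φ).mkQ = φ := by
      rw [b.constr_eq F (f := (LinearMap.ker φ).liftQ φ le_rfl) (fun _ => rfl),
        Submodule.liftQ_mkQ]
    refine ⟨_, ⟨fun _ => trivial, fun c hc => ?_⟩, hφ⟩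
    have h1 : (LinearMap.ker φ).liftQ φ le_rfl (∑ i, c i • b i) = 0 := by
      simpa [map_sum] using hc
    rw [← LinearMap.mem_ker, Submodule.ker_liftQ_eq_bot _ _ _ le_rfl, Submodule.mem_bot] at h1
    funext i
    exact Fintype.linearIndependent_iff.1 b.linearIndependent c h1 i

open Classical in
/-- The number of codewords of weight `i` of a lifted code whose columns span the space. -/
theorem ncard_liftedCode_hammingNorm {k n i : ℕ} {G : Matrix (Fin k) (Fin n) F}
    (hG : ∀ V : Submodule F (Fin k → F), (∀ m, (fun a => G a m) ∈ V) → V = ⊤) (hi : i ≠ 0) :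
    ({c | c ∈ liftedCode L G ∧ hammingNorm c = i}.ncard : ℚ) =
      ∑ j ∈ Finset.Icc 1 k, (subspaceCount G i j : ℚ) *
        ∏ s ∈ Finset.range j, ((Fintype.card L : ℚ) - (Fintype.card F : ℚ) ^ s) := by
  have hk : Module.finrank F (Fin k → F) = k := Module.finrank_fin_fun F
  have : Finite ((Fin k → F) →ₗ[F] L) := Finite.of_injective _ DFunLike.coe_injective
  have := Fintype.ofFinite ((Fin k → F) →ₗ[F] L)
  let ev : ((Fin k → F) →ₗ[F] L) → Fin n → L := fun φ m => φ (fun a => G a m)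
  have hinj : Function.Injective ev := by
    intro φ ψ h
    have := hG (LinearMap.ker (φ - ψ)) (fun m => by
      rw [LinearMap.mem_ker, LinearMap.sub_apply, sub_eq_zero]
      exact congrFun h m)
    rwa [LinearMap.ker_eq_top, sub_eq_zero] at this
  have himg : {c | c ∈ liftedCode L G ∧ hammingNorm c = i} = ev ''
      {φ | {m : Fin n | (fun a => G a m) ∈ LinearMap.ker φ}.ncard + i = n} := by
    ext c
    have hw : ∀ φ, {m : Fin n | (fun a => G a m) ∈ LinearMap.ker φ}.ncard +
        hammingNorm (ev φ) = n := fun φ => hammingNorm_add_ncard_zeros (ev φ)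
    constructor
    · rintro ⟨hc, rfl⟩
      obtain ⟨φ, rfl⟩ := mem_liftedCode_iff.1 hc
      exact ⟨φ, hw φ, rfl⟩
    · rintro ⟨φ, hφ, rfl⟩
      exact ⟨mem_liftedCode_iff.2 ⟨φ, rfl⟩, Nat.add_left_cancel ((hw φ).trans hφ.symm)⟩
  rw [himg, Set.ncard_image_of_injective _ hinj, Set.ncard_eq_toFinset_card',
    Finset.card_eq_sum_card_fiberwise (f := fun φ => k - Module.finrank F (LinearMap.ker φ))
      (t := Finset.Icc 1 k), Nat.cast_sum]
  · refine Finset.sum_congr rfl fun j hj => ?_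
    rw [← Set.ncard_coe_finset]
    refine ncard_eq_mul_of_fibers (f := fun φ => LinearMap.ker φ) ?_ ?_
    · intro φ hφ
      obtain ⟨h₁, h₂⟩ := by simpa using hφ
      have := Submodule.finrank_le (LinearMap.ker φ)
      exact ⟨by rw [hk] at this; omega, by simpa using h₁⟩
    · rintro V ⟨hV, hVi⟩
      rw [← ncard_ker_eq (hV.trans hk.symm)]
      congr 2
      ext φ
      simp only [Finset.coe_filter, Set.mem_toFinset, Set.mem_ofPred_eq]
      constructor
      · exact fun h => h.2
      · rintro rfl
        exact ⟨⟨hVi, by omega⟩, rfl⟩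
  · intro φ hφ
    have hφ' : {m : Fin n | (fun a => G a m) ∈ LinearMap.ker φ}.ncard + i = n := by
      simpa using hφ
    -- A kernel equal to the whole space would contain all n columns, forcing i = 0; hence j starts
    -- at 1.
    have hlt : Module.finrank F (LinearMap.ker φ) < k := by
      refine lt_of_lt_of_eq (Submodule.finrank_lt fun h => hi ?_) hk
      rw [h] at hφ'
      simpa [Set.ncard_univ] using hφ'
    simp only [Finset.coe_Icc, Set.mem_Icc]
    omega

end Code

/-! ### Column counts and the coefficients of the weight enumerator -/

section Columns

variable {F : Type*} [Field F] [Fintype F] {k n : ℕ} {S₁ S₂ : Submodule F (Fin k → F)}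
  {G : Matrix (Fin k) (Fin n) F}

theorem ncard_columns_mem_add (hS : S₁ ⊓ S₂ = ⊥)
    (hG : HasColumns G {v | v ∉ (S₁ : Set (Fin k → F)) ∪ (S₂ : Set (Fin k → F))})
    (V : Submodule F (Fin k → F)) :
    {m : Fin n | (fun a => G a m) ∈ V}.ncard +
      Fintype.card F ^ Module.finrank F (V ⊓ S₁ : Submodule F (Fin k → F)) +
      Fintype.card F ^ Module.finrank F (V ⊓ S₂ : Submodule F (Fin k → F)) =
      Fintype.card F ^ Module.finrank F V + 1 := by
  rw [← ncard_diff_union_add hS V]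
  congr 2
  rw [← hG.image_eq, Set.image_univ, ← Set.image_preimage_eq_inter_range,
    Set.ncard_image_of_injective _ (Set.injOn_univ.1 hG.injOn)]
  rfl

/-- Membership in the family counted by `subspaceCount`, for a pair of admissible dimensions. -/
theorem finrank_inf_of_isDimPair (hS : S₁ ⊓ S₂ = ⊥)
    (hG : HasColumns G {v | v ∉ (S₁ : Set (Fin k → F)) ∪ (S₂ : Set (Fin k → F))})
    {u₁ u₂ i j t₁ t₂ : ℕ} (hj : j ≤ k) (h : IsDimPair (Fintype.card F) k n u₁ u₂ i j t₁ t₂)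
    (V : Submodule F (Fin k → F)) :
    (Module.finrank F V + j = k ∧ {m : Fin n | (fun a => G a m) ∈ V}.ncard + i = n) ↔
      (Module.finrank F V = k - j ∧ Module.finrank F (V ⊓ S₁ : Submodule F (Fin k → F)) = t₁ ∧
        Module.finrank F (V ⊓ S₂ : Submodule F (Fin k → F)) = t₂) ∨
      (Module.finrank F V = k - j ∧ Module.finrank F (V ⊓ S₁ : Submodule F (Fin k → F)) = t₂ ∧
        Module.finrank F (V ⊓ S₂ : Submodule F (Fin k → F)) = t₁) := by
  have hc := ncard_columns_mem_add hS hG V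
  have hn := h.2.2
  have hdim : Module.finrank F V + j = k ↔ Module.finrank F V = k - j := by omega
  rw [hdim, ← and_or_left]
  refine and_congr_right fun hV => ?_
  rw [hV] at hc
  constructor
  · intro hi
    apply pow_add_pow_inj (Fintype.one_lt_card (α := F))
    zify at hc hi ⊢
    linarith
  · rintro (⟨h₁, h₂⟩ | ⟨h₁, h₂⟩) <;>
    · rw [h₁, h₂] at hc
      zify at hc ⊢
      linarith

/-- Any counted V supplies the pair (dim(V ∩ S₁), dim(V ∩ S₂)); codimension j lowers the dimension
of S_r by at most j. -/
theorem exists_isDimPair_of_subspaceCount_ne_zero (hS : S₁ ⊓ S₂ = ⊥)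
    (hG : HasColumns G {v | v ∉ (S₁ : Set (Fin k → F)) ∪ (S₂ : Set (Fin k → F))})
    {i j : ℕ} (h : subspaceCount G i j ≠ 0) :
    ∃ t₁ t₂, IsDimPair (Fintype.card F) k n (Module.finrank F S₁) (Module.finrank F S₂)
      i j t₁ t₂ := by
  obtain ⟨V, hV, hi⟩ := Set.nonempty_of_ncard_ne_zero h
  have hk : Module.finrank F (Fin k → F) = k := Module.finrank_fin_fun F
  have hc := ncard_columns_mem_add hS hG V
  have key : ∀ S : Submodule F (Fin k → F),
      Module.finrank F S ≤ Module.finrank F (V ⊓ S : Submodule F (Fin k → F)) + j ∧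
        Module.finrank F (V ⊓ S : Submodule F (Fin k → F)) ≤ Module.finrank F S := fun S => by
    have h₁ := Submodule.finrank_sup_add_finrank_inf_eq V S
    have h₂ := Submodule.finrank_le (V ⊔ S)
    exact ⟨by omega, Submodule.finrank_mono inf_le_right⟩
  refine ⟨_, _, key S₁, key S₂, ?_⟩
  rw [show k - j = Module.finrank F V by omega]
  zify at hc hi
  linarith

theorem subspaceCount_of_ne (hS : S₁ ⊓ S₂ = ⊥)
    (hG : HasColumns G {v | v ∉ (S₁ : Set (Fin k → F)) ∪ (S₂ : Set (Fin k → F))})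
    {u₁ u₂ i j t₁ t₂ : ℕ} (hj : j ≤ k) (h : IsDimPair (Fintype.card F) k n u₁ u₂ i j t₁ t₂)
    (ht : t₁ ≠ t₂) :
    (subspaceCount G i j : ℚ) =
      subspaceN (Fintype.card F) k (k - j) (Module.finrank F S₁) (Module.finrank F S₂) t₁ t₂ +
      subspaceN (Fintype.card F) k (k - j) (Module.finrank F S₁) (Module.finrank F S₂) t₂ t₁ := by
  have h₁ := ncard_finrank_inf hS (k - j) t₁ t₂
  have h₂ := ncard_finrank_inf hS (k - j) t₂ t₁
  rw [Module.finrank_fin_fun] at h₁ h₂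
  rw [← h₁, ← h₂, ← Nat.cast_add, ← Set.ncard_union_eq, Nat.cast_inj, subspaceCount]
  · congr 1
    ext V
    exact finrank_inf_of_isDimPair hS hG hj h V
  · rw [Set.disjoint_left]
    rintro V ⟨-, h₁, -⟩ ⟨-, h₂, -⟩
    exact ht (h₁.symm.trans h₂)

theorem subspaceCount_of_eq (hS : S₁ ⊓ S₂ = ⊥)
    (hG : HasColumns G {v | v ∉ (S₁ : Set (Fin k → F)) ∪ (S₂ : Set (Fin k → F))})
    {u₁ u₂ i j t : ℕ} (hj : j ≤ k) (h : IsDimPair (Fintype.card F) k n u₁ u₂ i j t t) :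
    (subspaceCount G i j : ℚ) =
      subspaceN (Fintype.card F) k (k - j) (Module.finrank F S₁) (Module.finrank F S₂) t t := by
  have h₁ := ncard_finrank_inf hS (k - j) t t
  rw [Module.finrank_fin_fun] at h₁
  rw [← h₁, Nat.cast_inj, subspaceCount]
  congr 1
  ext V
  exact (finrank_inf_of_isDimPair hS hG hj h V).trans (or_self_iff)

/-- Spanning is needed only for n ≠ 0: with no columns, both sides are 1, whether or not the empty
family spans. -/
theorem weightEnumerator_liftedCode {L : Type*} [Field L] [Fintype L] [Algebra F L]
    (hspan : n ≠ 0 → ∀ V : Submodule F (Fin k → F), (∀ m, (fun a => G a m) ∈ V) → V = ⊤) :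
    weightEnumerator (liftedCode L G) =
      1 + ∑ i ∈ Finset.Icc 1 n, ∑ j ∈ Finset.Icc 1 k,
        Polynomial.C ((subspaceCount G i j : ℤ) *
          ∏ s ∈ Finset.range j, ((Fintype.card L : ℤ) - (Fintype.card F : ℤ) ^ s)) *
            Polynomial.X ^ i := by
  classical
  rw [weightEnumerator, Finset.range_eq_Ico, Finset.sum_eq_sum_Ico_succ_bot (Nat.succ_pos n)]
  congr 1
  · have : {c | c ∈ liftedCode L G ∧ hammingNorm c = 0} = {0} := by
      ext c
      simp only [hammingNorm_eq_zero, Set.mem_ofPred_eq, Set.mem_singleton_iff]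
      exact ⟨fun h => h.2, fun h => ⟨h ▸ Submodule.zero_mem _, h⟩⟩
    rw [pow_zero, mul_one, ← Polynomial.C_1]
    congr 1
    rw [← Nat.cast_one, ← Set.ncard_singleton (0 : Fin n → L), ← this]
  · refine Finset.sum_congr rfl fun i hi => ?_
    obtain ⟨hi₁, hi₂⟩ := Finset.mem_Ico.1 hi
    rw [← Finset.sum_mul, ← map_sum]
    congr 2
    have h := ncard_liftedCode_hammingNorm (L := L) (hspan (by omega)) (i := i) (by omega)
    exact_mod_cast h

end Columns

theorem mainTheorem3 {F L : Type*} [Field F] [Fintype F] [Field L] [Fintype L] [Algebra F L]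
    (q ℓ k n u₁ u₂ : ℕ) (hq : Fintype.card F = q) (hL : Fintype.card L = q ^ ℓ)
    (S₁ S₂ : Submodule F (Fin k → F))
    (hu₁ : Module.finrank F S₁ = u₁) (hu₂ : Module.finrank F S₂ = u₂)
    (hS : Module.finrank F (S₁ ⊓ S₂ : Submodule F (Fin k → F)) = 0)
    -- the only case with `u₁, u₂ < k` in which the columns do not span `F ^ k`
    (hex : ¬ (q = 2 ∧ k = 2 ∧ u₁ = 1 ∧ u₂ = 1))
    (G : Matrix (Fin k) (Fin n) F)
    (hG : HasColumns G {v | v ∉ (S₁ : Set (Fin k → F)) ∪ (S₂ : Set (Fin k → F))}) :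
    -- the length
    (n : ℤ) = (q : ℤ) ^ k - (q : ℤ) ^ u₁ - (q : ℤ) ^ u₂ + 1 ∧
    -- the weight enumerator of the lifted code
    weightEnumerator (liftedCode L G) =
      1 + ∑ i ∈ Finset.Icc 1 n, ∑ j ∈ Finset.Icc 1 k,
        Polynomial.C ((subspaceCount G i j : ℤ) *
          ∏ s ∈ Finset.range j, ((q : ℤ) ^ ℓ - (q : ℤ) ^ s)) * Polynomial.X ^ i ∧
    -- the values of its coefficients
    (∀ i ∈ Finset.Icc 1 n, ∀ j ∈ Finset.Icc 1 k,
      (∀ t₁ t₂ : ℕ, IsDimPair q k n u₁ u₂ i j t₁ t₂ → t₁ ≠ t₂ →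
        (subspaceCount G i j : ℚ) =
          subspaceN q k (k - j) u₁ u₂ t₁ t₂ + subspaceN q k (k - j) u₁ u₂ t₂ t₁) ∧
      (∀ t₁ t₂ : ℕ, IsDimPair q k n u₁ u₂ i j t₁ t₂ → t₁ = t₂ →
        (subspaceCount G i j : ℚ) = subspaceN q k (k - j) u₁ u₂ t₁ t₂) ∧
      ((¬ ∃ t₁ t₂ : ℕ, IsDimPair q k n u₁ u₂ i j t₁ t₂) → subspaceCount G i j = 0)) ∧
    -- the meaning of the numbers `N(k, d, u₁, u₂, t₁, t₂)`
    (∀ d t₁ t₂ : ℕ,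
      ({V : Submodule F (Fin k → F) | Module.finrank F V = d ∧
        Module.finrank F (V ⊓ S₁ : Submodule F (Fin k → F)) = t₁ ∧
        Module.finrank F (V ⊓ S₂ : Submodule F (Fin k → F)) = t₂}.ncard : ℚ) =
          subspaceN q k d u₁ u₂ t₁ t₂) := by
  subst hq hu₁ hu₂
  rw [Submodule.finrank_eq_zero] at hS
  have hk : Module.finrank F (Fin k → F) = k := Module.finrank_fin_fun F
  refine ⟨?_, ?_, fun i _ j hj => ⟨fun t₁ t₂ h ht => ?_, ?_, ?_⟩, fun d t₁ t₂ => ?_⟩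
  · have h := ncard_columns_mem_add hS hG ⊤
    rw [top_inf_eq, top_inf_eq, finrank_top, hk] at h
    simp only [Submodule.mem_top, Set.ofPred_true, Set.ncard_univ, Nat.card_fin] at h
    zify at h
    linarith
  · have h := weightEnumerator_liftedCode (L := L) (G := G) fun hn V hV => by
      refine eq_top_of_compl_union_subset hS (by rwa [hk]) ?_ ?_
      · exact ⟨_, hG.mapsTo (Set.mem_univ (⟨0, Nat.pos_of_ne_zero hn⟩ : Fin n))⟩
      · intro v hv
        obtain ⟨m, -, rfl⟩ := hG.surjOn hv
        exact hV m
    rw [hL, Nat.cast_pow] at h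
    exact h
  · exact subspaceCount_of_ne hS hG (Finset.mem_Icc.1 hj).2 h ht
  · rintro t _ h rfl
    exact subspaceCount_of_eq hS hG (Finset.mem_Icc.1 hj).2 h
  · intro h
    by_contra h0
    exact h (exists_isDimPair_of_subspaceCount_ne_zero hS hG h0)
  · have h := ncard_finrank_inf hS d t₁ t₂
    rwa [hk] at h
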